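/- **Setting.** Let $q$ be a prime power. A discrete memoryless channel with input alphabet $\mathbb F_q$ and finite output alphabet $\mathcal Y$ is given by transition probabilities $W(y\mid x)$. It is *weakly symmetric* if $\mathcal Y$ has a partition $Y_1\cup\dots\cup Y_t$ such that in each submatrix $(W(y\mid x))_{x\in\mathbb F_q,\,y\in Y_i}$ all rows are permutations of each other and all columns are permutations of each other. For uniformly distributed input, let $\pi_y(\alpha)=W(y\mid\alpha)/\sum_{\beta}W(y\mid\beta)$ be the a posteriori probabilities; the *Koetter–Vardy capacity* is $C_{KV}=\mathbb E_y\big(\sum_{\alpha\in\mathbb F_q}\pi_y(\alpha)^2\big)$, where $y$ is the output for a uniformly distributed input. Let $x_1,\dots,x_n\in\mathbb F_q$ be distinct and $2\le k\le n$. The Reed–Solomon code of length $n$ and dimension $k$ is $\{(f(x_1),\dots,f(x_n)) : f\in\mathbb F_q[X],\ \deg f<k\}$. **Decoder.** For an integer $L$, the *Koetter–Vardy decoder with list size bounded by $L$* works as follows on a received word $(y_1,\dots,y_n)$. Put $\Pi_{\alpha,j}=\pi_{y_j}(\alpha)$. Starting from the zero matrix, build a $q\times n$ nonnegative integer matrix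 $M$ by repeatedly adding $1$ to an entry at which $\Pi_{\alpha,j}/(m_{\alpha,j}+1)$ is largest (ties broken arbitrarily), for a number of steps such that $L\le\sqrt{2C(M)/(k-1)}<L+1$, where $C(M)=\frac12\sum_{\alpha,j}m_{\alpha,j}(m_{\alpha,j}+1)$. Take a nonzero polynomial $Q(X,Y)$ over $\mathbb F_q$ of minimal $(1,k-1)$-weighted degree among those that vanish with multiplicity at least $m_{\alpha,j}$ at $(x_j,\alpha)$ for all $\alpha,j$. The output list consists of the codewords $(f(x_1),\dots,f(x_n))$ for all $f$ with $\deg f<k$ and $Y-f(X)\mid Q(X,Y)$. **Theorem.** For every $R_0>0$ there are constants $K>0$ and $A>0$, depending only on $R_0$, such that the following holds for all $q$, all weakly symmetric channels with input alphabet $\mathbb F_q$, and all Reed–Solomon codes over $\mathbb F_q$ of length $n$ and dimension $k\ge2$ whose rate $R=k/n$ satisfies $R_0\le R<C_{KV}$. Let $$\delta=\frac{C_{KV}-R}{R},\qquad R^*=\frac{k-1}{n},\qquad L=\left\lceil\frac{3\left(\frac1{R^*}+\frac{\sqrt q}{2\sqrt{R^*}}\right)\left(1+\frac\delta3\right)}{\delta}\right\rceil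 .$$ Then for every codeword $c$ sent over the channel (with independent uses), the probability that the Koetter–Vardy decoder with list size bounded by $L$ does not output $c$ in its list is at most $A\,e^{-K\delta^2 n}$, whatever choices (ties, number of steps within the allowed window, choice of $Q$) the decoder makes. -/

import Mathlib

universe u v

namespace KoetterVardy

/-- A discrete channel with finite input alphabet `X` and finite output alphabet `Y`:
`W x y` is the probability of receiving `y` when `x` is sent. -/
structure Channel (X : Type u) (Y : Type v) [Fintype Y] where
  /-- the transition probabilities -/
  W : X → Y → ℝ
  nonneg : ∀ x y, 0 ≤ W x y
  sum_eq_one : ∀ x, ∑ y, W x y = 1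

/-- All rows are permutations of each other, and all columns are permutations of each other. -/
def IsSymmetricMatrix {X : Type u} {S : Type v} (A : X → S → ℝ) : Prop :=
  (∀ x x' : X, ∃ σ : Equiv.Perm S, ∀ y, A x' y = A x (σ y)) ∧
    (∀ y y' : S, ∃ τ : Equiv.Perm X, ∀ x, A x y' = A (τ x) y)

section Channels

variable {X : Type u} {Y : Type v} [Fintype X] [Fintype Y]

/-- The output alphabet can be partitioned so that all the corresponding submatrices of the
transition matrix are symmetric. -/
def Channel.IsWeaklySymmetric {X : Type u} {Y : Type v} [Fintype Y] [DecidableEq Y]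
    (ch : Channel X Y) : Prop :=
  ∃ P : Finpartition (Finset.univ : Finset Y), ∀ S ∈ P.parts,
    IsSymmetricMatrix (fun (x : X) (y : S) => ch.W x y)

/-- The a posteriori probability `prob (x = α | y)` for a uniformly distributed input.
(Outputs `y` that can never be received get the value `0`.) -/
noncomputable def Channel.app (ch : Channel X Y) (y : Y) (α : X) : ℝ :=
  ch.W α y / ∑ β, ch.W β y

/-- The Koetter-Vardy capacity `𝔼 ‖π‖²`, where the output `y` is the one that belongs to a
uniformly distributed input. -/
noncomputable def Channel.kvCapacity (ch : Channel X Y) : ℝ :=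
  ∑ y, ((1 / (Fintype.card X : ℝ)) * ∑ x, ch.W x y) * ∑ α, ch.app y α ^ 2

/-- The probability, under `n` independent uses of the channel, that the received word lies in
the set `E` when the word `c` is sent. -/
noncomputable def Channel.prob {n : ℕ} (ch : Channel X Y) (c : Fin n → X)
    (E : Set (Fin n → Y)) : ℝ :=
  ∑ y : Fin n → Y, E.indicator (fun y => ∏ j, ch.W (c j) (y j)) y

/-- The reliability matrix of a received word. -/
noncomputable def Channel.reliability {n : ℕ} (ch : Channel X Y) (y : Fin n → Y) :
    Matrix X (Fin n) ℝ :=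
  Matrix.of fun α j => ch.app (y j) α

end Channels

section Decoder

variable {F : Type u} [Field F] {n : ℕ}

/-- The Reed-Solomon code of all evaluation vectors of polynomials of degree `< k` at the points
`x j`. -/
noncomputable def reedSolomon (x : Fin n → F) (k : ℕ) : Submodule F (Fin n → F) :=
  (Polynomial.degreeLT F k).map (LinearMap.pi fun j => Polynomial.leval (x j))

/-- `IsMultiplicityMatrix P s M`: the greedy multiplicity assignment algorithm, run on the
matrix `P` for `s` steps, can return `M`. It starts with `M = 0`, and each step adds `1` to an
entry of `M` at a position where `π i j / (m i j + 1)` is largest (ties are broken in any way). -/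
inductive IsMultiplicityMatrix [DecidableEq F] (P : Matrix F (Fin n) ℝ) :
    ℕ → Matrix F (Fin n) ℕ → Prop
  | zero : IsMultiplicityMatrix P 0 0
  | step {s : ℕ} {M : Matrix F (Fin n) ℕ} (i : F) (j : Fin n)
      (h : IsMultiplicityMatrix P s M)
      (hmax : ∀ i' j', P i' j' / ((M i' j' : ℝ) + 1) ≤ P i j / ((M i j : ℝ) + 1)) :
      IsMultiplicityMatrix P (s + 1) (M + Matrix.single i j 1)

/-- The cost of a multiplicity matrix. -/
noncomputable def cost [Fintype F] (M : Matrix F (Fin n) ℕ) : ℝ :=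
  1 / 2 * ∑ i, ∑ j, (M i j : ℝ) * ((M i j : ℝ) + 1)

/-- The bound on the number of codewords on the list for the multiplicity matrix `M`. -/
noncomputable def listBound [Fintype F] (k : ℕ) (M : Matrix F (Fin n) ℕ) : ℝ :=
  √(2 * cost M / ((k : ℝ) - 1))

open Polynomial in
/-- The bivariate polynomial `Q (X, Y)`, as an element of `F[X][Y]`, has a zero of multiplicity
at least `m` at `(a, b)`: no monomial of total degree `< m` occurs in `Q (X + a, Y + b)`. -/
noncomputable def HasZeroOfMultiplicity (Q : F[X][X]) (a b : F) (m : ℕ) : Prop :=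
  ∀ i j : ℕ, i + j < m →
    (((Q.map (compRingHom (X + C a))).comp (X + C (C b))).coeff j).coeff i = 0

open Polynomial in
/-- The `(1, w)`-weighted degree of `Q (X, Y)`: the largest `i + w * j` over all the monomials
`X ^ i * Y ^ j` that occur in `Q` (and `0` for `Q = 0`). -/
noncomputable def weightedDegree (w : ℕ) (Q : F[X][X]) : ℕ :=
  Q.support.sup fun j => (Q.coeff j).natDegree + w * j

open Polynomial in
/-- `Q` passes through every point `(x j, α)` with multiplicity at least `M α j`. -/
def Interpolates (x : Fin n → F) (M : Matrix F (Fin n) ℕ) (Q : F[X][X]) : Prop :=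
  ∀ α j, HasZeroOfMultiplicity Q (x j) α (M α j)

open Polynomial in
/-- `Q` is a possible outcome of the interpolation step: a nonzero interpolating polynomial of
minimal `(1, k - 1)`-weighted degree. -/
def IsInterpolationPolynomial (x : Fin n → F) (k : ℕ) (M : Matrix F (Fin n) ℕ)
    (Q : F[X][X]) : Prop :=
  Q ≠ 0 ∧ Interpolates x M Q ∧
    ∀ Q' : F[X][X], Q' ≠ 0 → Interpolates x M Q' →
      weightedDegree (k - 1) Q ≤ weightedDegree (k - 1) Q'

open Polynomial in
/-- The factorization step: the codewords of all polynomials `f` of degree `< k` for which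
`Y - f (X)` divides `Q`. -/
def factorList (x : Fin n → F) (k : ℕ) (Q : F[X][X]) : Set (Fin n → F) :=
  {c | ∃ f : F[X], f ∈ degreeLT F k ∧ (X - C f) ∣ Q ∧ ∀ j, c j = f.eval (x j)}

/-- `l` is a possible output of algebraic soft-decoding with list size limited to `L`, run on
the reliability matrix `P`: the number of steps of the multiplicity assignment is chosen
such that the bound on the list size lies in `[L, L + 1)`, and interpolation and factorization
follow. -/
def IsDecoderOutput [Fintype F] [DecidableEq F] (x : Fin n → F) (k L : ℕ)
    (P : Matrix F (Fin n) ℝ) (l : Set (Fin n → F)) : Prop :=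
  ∃ (s : ℕ) (M : Matrix F (Fin n) ℕ) (Q : Polynomial (Polynomial F)),
    IsMultiplicityMatrix P s M ∧
    (L : ℝ) ≤ listBound k M ∧ listBound k M < (L : ℝ) + 1 ∧
    IsInterpolationPolynomial x k M Q ∧
    l = factorList x k Q

/-- `dec` is a Koetter-Vardy decoder with list size bounded by `L` for the Reed-Solomon code of
dimension `k` with evaluation points `x`, used on the channel `ch`. The only freedom is in the
choices that the algorithm leaves open. -/
def IsKoetterVardyDecoder [Fintype F] [DecidableEq F] {Y : Type v} [Fintype Y]
    (ch : Channel F Y) (x : Fin n → F) (k L : ℕ) (dec : (Fin n → Y) → Set (Fin n → F)) : Prop :=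
  ∀ y, IsDecoderOutput x k L (ch.reliability y) (dec y)

section Existence

/-- The next lemmas show that the decoder is well defined: it always has an output. -/
theorem exists_isMultiplicityMatrix_window [Fintype F] [DecidableEq F] (P : Matrix F (Fin n) ℝ) (hn : 0 < n) (L w : ℕ)
    (hw : 0 < w) : ∃ (s : ℕ) (M : Matrix F (Fin n) ℕ), IsMultiplicityMatrix P s M ∧
      L ^ 2 * w ≤ ∑ i, ∑ j, M i j * (M i j + 1) ∧
      ∑ i, ∑ j, M i j * (M i j + 1) < (L + 1) ^ 2 * w := by
  by_contra hcon
  push Not at hcon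
  have key : ∀ s, ∃ M : Matrix F (Fin n) ℕ, IsMultiplicityMatrix P s M ∧
      s ≤ ∑ i, ∑ j, M i j * (M i j + 1) ∧ ∑ i, ∑ j, M i j * (M i j + 1) < L ^ 2 * w := by
    intro s
    induction s with
    | zero =>
      refine ⟨0, .zero, by simp, ?_⟩
      by_contra h
      have h1 := hcon 0 0 .zero (not_lt.mp h)
      have h2 : 0 < (L + 1) ^ 2 * w := by positivity
      simp at h1
      omega
    | succ s ih =>
      obtain ⟨M, hM, hs, hlt⟩ := ih
      have : Nonempty (Fin n) := ⟨⟨0, hn⟩⟩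
      obtain ⟨⟨i, j⟩, hmax⟩ := Finite.exists_max
        (fun p : F × Fin n => P p.1 p.2 / ((M p.1 p.2 : ℝ) + 1))
      have hM' := IsMultiplicityMatrix.step i j hM (fun i' j' => hmax (i', j'))
      have hD : ∑ a, ∑ b, (M + Matrix.single i j 1 : Matrix F (Fin n) ℕ) a b *
          ((M + Matrix.single i j 1 : Matrix F (Fin n) ℕ) a b + 1) =
          ∑ a, ∑ b, M a b * (M a b + 1) + 2 * (M i j + 1) := by
        have h1 : ∀ a b, (M + Matrix.single i j 1 : Matrix F (Fin n) ℕ) a b *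
          ((M + Matrix.single i j 1 : Matrix F (Fin n) ℕ) a b + 1) =
          M a b * (M a b + 1) + if i = a then (if j = b then 2 * (M i j + 1) else 0) else 0 := by
          intro a b
          by_cases ha : i = a
          · by_cases hb : j = b
            · subst ha hb
              simp
              ring
            · simp [hb]
          · simp [ha]
        simp only [h1, Finset.sum_add_distrib]
        simp
      have hmle : M i j * (M i j + 1) ≤ ∑ a, ∑ b, M a b * (M a b + 1) :=
        (Finset.single_le_sum (f := fun b => M i b * (M i b + 1))
          (fun _ _ => Nat.zero_le _) (Finset.mem_univ j)).trans
          (Finset.single_le_sum (f := fun a => ∑ b, M a b * (M a b + 1))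
          (fun _ _ => Nat.zero_le _) (Finset.mem_univ i))
      refine ⟨_, hM', by omega, ?_⟩
      by_contra h
      have h1 := hcon _ _ hM' (not_lt.mp h)
      rw [hD] at h1
      have h2 : M i j < L * w := by
        by_contra h3
        push Not at h3
        nlinarith [Nat.mul_le_mul h3 h3, Nat.mul_le_mul_left (L ^ 2 * w) hw]
      nlinarith
  obtain ⟨M, -, h1, h2⟩ := key (L ^ 2 * w)
  omega

open Polynomial in
theorem exists_isInterpolationPolynomial [Fintype F] (x : Fin n → F) (k : ℕ) (M : Matrix F (Fin n) ℕ) :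
    ∃ Q, IsInterpolationPolynomial x k M Q := by
  have hex : ∃ d, ∃ Q : F[X][X], Q ≠ 0 ∧ Interpolates x M Q ∧ weightedDegree (k - 1) Q = d := by
    refine ⟨_, C (∏ j, ∏ α, (X - C (x j)) ^ M α j), ?_, ?_, rfl⟩
    · rw [Ne, C_eq_zero, Finset.prod_eq_zero_iff]
      rintro ⟨j, -, hj⟩
      rw [Finset.prod_eq_zero_iff] at hj
      obtain ⟨α, -, h⟩ := hj
      exact pow_ne_zero _ (X_sub_C_ne_zero (x j)) h
    · intro α j a b hab
      rw [map_C, C_comp, coeff_C]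
      split_ifs
      · have hdvd : (X : F[X]) ^ M α j ∣
            compRingHom (X + C (x j)) (∏ j, ∏ α, (X - C (x j)) ^ M α j) := by
          have h1 : (X - C (x j)) ^ M α j ∣ ∏ j, ∏ α, (X - C (x j)) ^ M α j :=
            (Finset.dvd_prod_of_mem (fun α => (X - C (x j)) ^ M α j)
              (Finset.mem_univ α)).trans
            (Finset.dvd_prod_of_mem (fun j => ∏ α, (X - C (x j)) ^ M α j)
              (Finset.mem_univ j))
          have h2 := map_dvd (compRingHom (X + C (x j))) h1
          simpa using h2
        exact X_pow_dvd_iff.mp hdvd a (by omega)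
      · simp
  classical
  obtain ⟨Q, h0, hQ, hd⟩ := Nat.find_spec hex
  exact ⟨Q, h0, hQ, fun Q' h0' hQ' => hd ▸ Nat.find_min' hex ⟨Q', h0', hQ', rfl⟩⟩

theorem exists_isKoetterVardyDecoder [Fintype F] [DecidableEq F] {Y : Type v} [Fintype Y]
    (ch : Channel F Y) (x : Fin n → F) (hn : 0 < n) (k L : ℕ) (hk : 2 ≤ k) :
    ∃ dec, IsKoetterVardyDecoder ch x k L dec := by
  have : ∀ y : Fin n → Y, ∃ l, IsDecoderOutput x k L (ch.reliability y) l := by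
    intro y
    obtain ⟨w, rfl⟩ : ∃ w, k = w + 1 := ⟨k - 1, by omega⟩
    obtain ⟨s, M, hM, h1, h2⟩ :=
      exists_isMultiplicityMatrix_window (ch.reliability y) hn L w (by omega)
    obtain ⟨Q, hQ⟩ := exists_isInterpolationPolynomial x (w + 1) M
    have hw : (0 : ℝ) < w := by
      have : 0 < w := by omega
      exact_mod_cast this
    have hB : listBound (w + 1) M =
        √(((∑ i, ∑ j, M i j * (M i j + 1) : ℕ) : ℝ) / w) := by
      unfold listBound cost
      push_cast
      congr 1
      congr 1 <;> ring
    have h1' : ((L : ℝ)) ^ 2 * w ≤ ((∑ i, ∑ j, M i j * (M i j + 1) : ℕ) : ℝ) := by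
      exact_mod_cast h1
    have h2' : ((∑ i, ∑ j, M i j * (M i j + 1) : ℕ) : ℝ) < ((L : ℝ) + 1) ^ 2 * w := by
      exact_mod_cast h2
    refine ⟨_, s, M, Q, hM, ?_, ?_, hQ, rfl⟩
    · rw [hB]
      exact Real.le_sqrt_of_sq_le ((le_div_iff₀ hw).mpr h1')
    · rw [hB, Real.sqrt_lt' (by positivity)]
      exact (div_lt_iff₀ hw).mpr h2'
  choose dec hdec using this
  exact ⟨dec, hdec⟩

end Existence

end Decoder

end KoetterVardy

/-!
A polynomial `Q (X, Y)` has about `D ^ 2 / (2 * (k - 1))` monomials of `(1, k - 1)`-weighted degree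
at most `D`, and the multiplicity matrix `M` imposes `cost M` linear conditions. Hence an
interpolation polynomial has weighted degree at most `√(2 * (k - 1) * cost M)`
(`IsInterpolationPolynomial.weightedDegree_le`), while `Q (X, f (X))` has `∑ j, M (c j) j` zeros,
counted with multiplicity, if `f` is the message polynomial of the codeword `c`. So `c` is on the
list as soon as its score `∑ j, M (c j) j` exceeds this square root
(`mem_factorList_of_weightedDegree_lt`).

The greedy algorithm keeps `M` within rounding errors of a multiple `lam * Π` of the reliability
matrix (`IsMultiplicityMatrix.exists_scale`). With `ρ = (∑ j, Π (c j) j) / n` and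
`ν = (∑ j, ∑ α, Π α j ^ 2) / n`, the condition for success becomes
`√(R* * (lam ^ 2 * ν + lam)) < lam * ρ - 1`. For a weakly symmetric channel both `ρ` and `ν` are
averages of `n` independent random variables in `[0, 1]` whose expectation is the Koetter-Vardy
capacity `R * (1 + δ)`, whatever letters are sent (`Channel.IsWeaklySymmetric.sum_mul_app`,
`Channel.IsWeaklySymmetric.sum_mul_sum_app_sq`). By a Chernoff bound (`Channel.prob_sum_ge_le`),
they deviate from it by more than a small multiple of `δ` only with exponentially small
probability.

For `ρ` and `ν` in this range the condition for success is an inequality between real numbers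
(`sqrt_lt_score`). For `lam → ∞` it compares `√(R* * ν) ≈ R * √(1 + δ)` with `ρ ≈ R * (1 + δ)`, which
leaves a gap of order `R * δ`. The lower bound on `L` forces `lam` to be of order at least
`3 / (R * δ)`, because `ν ≥ 1 / q`, and this is just enough to cover the rounding errors. The term of
`L` that contains `√q` leaves a surplus, proportional to `δ` with a factor that depends only on
`R₀`, which accommodates the deviations of `ρ` and `ν`.
-/

/-! ### Concentration for memoryless channels -/

namespace KoetterVardy

section Concentration

variable {X : Type u} {Y : Type v} [Fintype Y] {n : ℕ}

theorem Channel.prob_mono_of_pos (ch : Channel X Y) (c : Fin n → X) {E E' : Set (Fin n → Y)}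
    (h : ∀ y ∈ E, 0 < ∏ j, ch.W (c j) (y j) → y ∈ E') : ch.prob c E ≤ ch.prob c E' := by
  classical
  refine Finset.sum_le_sum fun y _ => ?_
  have h0 : 0 ≤ ∏ j, ch.W (c j) (y j) := Finset.prod_nonneg fun j _ => ch.nonneg _ _
  by_cases hE : y ∈ E
  · rcases h0.eq_or_lt with h1 | h1
    · simp [Set.indicator_apply, ← h1]
    · simp [hE, h y hE h1]
  · simp only [Set.indicator_apply, hE, if_false]
    split_ifs <;> first | exact h0 | exact le_rfl

theorem Channel.prob_union_le (ch : Channel X Y) (c : Fin n → X) (E E' : Set (Fin n → Y)) :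
    ch.prob c (E ∪ E') ≤ ch.prob c E + ch.prob c E' := by
  classical
  unfold Channel.prob
  rw [← Finset.sum_add_distrib]
  refine Finset.sum_le_sum fun y _ => ?_
  have h0 : 0 ≤ ∏ j, ch.W (c j) (y j) := Finset.prod_nonneg fun j _ => ch.nonneg _ _
  by_cases h1 : y ∈ E <;> by_cases h2 : y ∈ E' <;> simp [h1, h2, h0]

/-- Bernstein-type bound on the moment generating function of a centred random variable with
values in `[-1, 1]`. -/
theorem sum_mul_exp_le {p g : Y → ℝ} (hp : ∀ y, 0 ≤ p y) (hp1 : ∑ y, p y = 1)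
    (hg : ∀ y, |g y| ≤ 1) (hg0 : ∑ y, p y * g y = 0) {t : ℝ} (ht0 : 0 ≤ t) (ht1 : t ≤ 1) :
    ∑ y, p y * Real.exp (t * g y) ≤ Real.exp (t ^ 2) := by
  have h : ∀ y, p y * Real.exp (t * g y) ≤ p y + t * (p y * g y) + p y * t ^ 2 := by
    intro y
    have habs : |t * g y| ≤ t := by
      rw [abs_mul, abs_of_nonneg ht0]
      exact mul_le_of_le_one_right ht0 (hg y)
    have h1 := (abs_le.mp (Real.abs_exp_sub_one_sub_id_le (habs.trans ht1))).2
    have h2 : (t * g y) ^ 2 ≤ t ^ 2 := sq_le_sq' (abs_le.mp habs).1 (abs_le.mp habs).2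
    have h3 : Real.exp (t * g y) ≤ 1 + t * g y + t ^ 2 := by linarith
    calc p y * Real.exp (t * g y) ≤ p y * (1 + t * g y + t ^ 2) :=
          mul_le_mul_of_nonneg_left h3 (hp y)
      _ = _ := by ring
  calc ∑ y, p y * Real.exp (t * g y) ≤ ∑ y, (p y + t * (p y * g y) + p y * t ^ 2) :=
        Finset.sum_le_sum fun y _ => h y
    _ = t ^ 2 + 1 := by
        rw [Finset.sum_add_distrib, Finset.sum_add_distrib, ← Finset.mul_sum, ← Finset.sum_mul,
          hp1, hg0]
        ring
    _ ≤ Real.exp (t ^ 2) := Real.add_one_le_exp _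

/-- A Chernoff bound: the sum of `n` centred functions of the received letters, with values in
`[-1, 1]`, exceeds `n * θ` with exponentially small probability. -/
theorem Channel.prob_sum_ge_le (ch : Channel X Y) (c : Fin n → X) (g : Fin n → Y → ℝ)
    (hg : ∀ j y, |g j y| ≤ 1) (hg0 : ∀ j, ∑ y, ch.W (c j) y * g j y = 0) {θ : ℝ}
    (hθ0 : 0 ≤ θ) (hθ1 : θ ≤ 1) :
    ch.prob c {y | n * θ ≤ ∑ j, g j (y j)} ≤ Real.exp (-(θ ^ 2 / 4 * n)) := by
  classical
  -- the exponent `θ / 2` minimizes `t ^ 2 - t * θ`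
  set t := θ / 2 with ht
  have h1 : ch.prob c {y | n * θ ≤ ∑ j, g j (y j)} ≤
      ∑ y : Fin n → Y, Real.exp (-(t * (n * θ))) *
        ∏ j, (ch.W (c j) (y j) * Real.exp (t * g j (y j))) := by
    refine Finset.sum_le_sum fun y _ => ?_
    have h0 : 0 ≤ ∏ j, ch.W (c j) (y j) := Finset.prod_nonneg fun j _ => ch.nonneg _ _
    rw [Finset.prod_mul_distrib, ← Real.exp_sum, ← Finset.mul_sum, mul_left_comm, ← Real.exp_add,
      Set.indicator_apply]
    split_ifs with hy
    · refine le_mul_of_one_le_right h0 (Real.one_le_exp ?_)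
      have := mul_le_mul_of_nonneg_left (show n * θ ≤ ∑ j, g j (y j) from hy)
        (show 0 ≤ t by positivity)
      linarith
    · positivity
  refine h1.trans ?_
  rw [← Finset.mul_sum,
    ← Fintype.prod_sum (fun j y => ch.W (c j) y * Real.exp (t * g j y))]
  have h2 : ∏ j, ∑ y, ch.W (c j) y * Real.exp (t * g j y) ≤ ∏ _j : Fin n, Real.exp (t ^ 2) := by
    refine Finset.prod_le_prod
      (fun j _ => Finset.sum_nonneg fun y _ => mul_nonneg (ch.nonneg _ _) (Real.exp_pos _).le)
      fun j _ => sum_mul_exp_le (ch.nonneg _) (ch.sum_eq_one _) (hg j) (hg0 j) (by positivity)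
        (by linarith)
  refine (mul_le_mul_of_nonneg_left h2 (Real.exp_pos _).le).trans_eq ?_
  rw [Finset.prod_const, Finset.card_univ, Fintype.card_fin, ← Real.exp_nat_mul, ← Real.exp_add,
    ht]
  congr 1
  ring

end Concentration

end KoetterVardy

/-! ### A posteriori probabilities of weakly symmetric channels -/

namespace KoetterVardy

section Symmetry

variable {X : Type u} {Y : Type v} [Fintype X] [Fintype Y]

theorem Channel.app_nonneg (ch : Channel X Y) (y : Y) (α : X) : 0 ≤ ch.app y α :=
  div_nonneg (ch.nonneg _ _) (Finset.sum_nonneg fun _ _ => ch.nonneg _ _)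

theorem Channel.app_le_one (ch : Channel X Y) (y : Y) (α : X) : ch.app y α ≤ 1 :=
  div_le_one_of_le₀
    (Finset.single_le_sum (f := fun β => ch.W β y) (fun _ _ => ch.nonneg _ _) (Finset.mem_univ α))
    (Finset.sum_nonneg fun _ _ => ch.nonneg _ _)

theorem Channel.sum_W_pos (ch : Channel X Y) {y : Y} {α : X} (h : 0 < ch.W α y) :
    0 < ∑ β, ch.W β y :=
  h.trans_le (Finset.single_le_sum (f := fun β => ch.W β y) (fun _ _ => ch.nonneg _ _)
    (Finset.mem_univ α))

theorem Channel.sum_app (ch : Channel X Y) {y : Y} {α : X} (h : 0 < ch.W α y) :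
    ∑ β, ch.app y β = 1 := by
  unfold Channel.app
  rw [← Finset.sum_div, div_self (ch.sum_W_pos h).ne']

theorem Channel.sum_app_le_one (ch : Channel X Y) (y : Y) : ∑ β, ch.app y β ≤ 1 := by
  unfold Channel.app
  rw [← Finset.sum_div]
  exact div_self_le_one _

theorem Channel.sum_app_sq_nonneg (ch : Channel X Y) (y : Y) : 0 ≤ ∑ α, ch.app y α ^ 2 :=
  Finset.sum_nonneg fun _ _ => sq_nonneg _

theorem Channel.sum_app_sq_le_one (ch : Channel X Y) (y : Y) : ∑ α, ch.app y α ^ 2 ≤ 1 :=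
  (Finset.sum_le_sum fun α _ =>
    pow_le_of_le_one (ch.app_nonneg y α) (ch.app_le_one y α) two_ne_zero).trans
    (ch.sum_app_le_one y)

/-- A function of the input letter that is constant and whose average is `a` has the value `a`. -/
theorem eq_of_const_of_average {g : X → ℝ} {a : ℝ} (hg : ∀ x x', g x = g x')
    (ha : 1 / (Fintype.card X : ℝ) * ∑ x, g x = a) (x : X) : g x = a := by
  have hX : (Fintype.card X : ℝ) ≠ 0 := by
    have : Nonempty X := ⟨x⟩
    exact_mod_cast Fintype.card_ne_zero
  rw [← ha, Finset.sum_congr rfl fun x' _ => hg x' x, Finset.sum_const, Finset.card_univ,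
    nsmul_eq_mul]
  field_simp

theorem sum_eq_sum_parts [DecidableEq Y] (P : Finpartition (Finset.univ : Finset Y)) (g : Y → ℝ) :
    ∑ y, g y = ∑ S ∈ P.parts, ∑ y : S, g y := by
  have h := Finset.sum_biUnion (f := g) P.supIndep.pairwiseDisjoint
  rw [P.biUnion_parts] at h
  simp only [id] at h
  rw [h]
  exact Finset.sum_congr rfl fun S _ => (Finset.sum_coe_sort S g).symm

/-- On a block of the output alphabet with permuted columns, each symmetric function of a column
is constant; with permuted rows, the sum along a row does not depend on the row. -/
theorem Channel.IsWeaklySymmetric.sum_eq_sum {X : Type u} [DecidableEq Y] {ch : Channel X Y}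
    (h : ch.IsWeaklySymmetric) (Φ : (X → ℝ) → ℝ) (φ : ℝ → ℝ → ℝ)
    (hΦ : ∀ (v : X → ℝ) (τ : Equiv.Perm X), Φ (fun x => v (τ x)) = Φ v) (x x' : X) :
    ∑ y, φ (ch.W x y) (Φ fun α => ch.W α y) = ∑ y, φ (ch.W x' y) (Φ fun α => ch.W α y) := by
  obtain ⟨P, hP⟩ := h
  rw [sum_eq_sum_parts P, sum_eq_sum_parts P]
  refine Finset.sum_congr rfl fun S hS => ?_
  obtain ⟨σ, hσ⟩ := (hP S hS).1 x' x
  rw [← Equiv.sum_comp σ (fun y : S => φ (ch.W x' y) (Φ fun α => ch.W α y))]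
  refine Finset.sum_congr rfl fun y _ => ?_
  obtain ⟨τ, hτ⟩ := (hP S hS).2 (σ y) y
  have h1 : (fun α => ch.W α y) = fun α => ch.W (τ α) (σ y) := funext hτ
  have h2 : ch.W x y = ch.W x' (σ y) := hσ y
  rw [h2, h1, hΦ (fun α => ch.W α (σ y)) τ]

/-- For each input letter, the expected a posteriori probability of this letter is the
Koetter-Vardy capacity. -/
theorem Channel.IsWeaklySymmetric.sum_mul_app [DecidableEq Y] {ch : Channel X Y}
    (h : ch.IsWeaklySymmetric) (x : X) : ∑ y, ch.W x y * ch.app y x = ch.kvCapacity := by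
  refine eq_of_const_of_average (g := fun x : X => ∑ y : Y, ch.W x y * ch.app y x)
    (fun x x' => ?_) ?_ x
  · exact h.sum_eq_sum (fun v => ∑ β : X, v β) (fun a s => a * (a / s))
      (fun v τ => by exact Equiv.sum_comp τ v) x x'
  · unfold Channel.kvCapacity
    rw [Finset.sum_comm, Finset.mul_sum]
    refine Finset.sum_congr rfl fun y _ => ?_
    rw [mul_assoc]
    congr 1
    rw [Finset.mul_sum]
    refine Finset.sum_congr rfl fun α _ => ?_
    unfold Channel.app
    rcases eq_or_ne (∑ β, ch.W β y) 0 with h0 | h0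
    · simp [h0]
    · field_simp

/-- For each input letter, the expected squared norm of the a posteriori distribution is the
Koetter-Vardy capacity. -/
theorem Channel.IsWeaklySymmetric.sum_mul_sum_app_sq [DecidableEq Y] {ch : Channel X Y}
    (h : ch.IsWeaklySymmetric) (x : X) :
    ∑ y, ch.W x y * ∑ α, ch.app y α ^ 2 = ch.kvCapacity := by
  refine eq_of_const_of_average (g := fun x : X => ∑ y : Y, ch.W x y * ∑ α, ch.app y α ^ 2)
    (fun x x' => ?_) ?_ x
  · refine h.sum_eq_sum (fun v => ∑ α : X, (v α / ∑ β : X, v β) ^ 2) (fun a s => a * s)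
      (fun v τ => ?_) x x'
    rw [Equiv.sum_comp τ v]
    exact Equiv.sum_comp τ fun α => (v α / ∑ β, v β) ^ 2
  · unfold Channel.kvCapacity
    rw [Finset.sum_comm, Finset.mul_sum]
    refine Finset.sum_congr rfl fun y _ => ?_
    rw [← Finset.sum_mul, mul_assoc]

theorem Channel.IsWeaklySymmetric.kvCapacity_mem_Icc [DecidableEq Y] {ch : Channel X Y}
    (h : ch.IsWeaklySymmetric) (x : X) : ch.kvCapacity ∈ Set.Icc (0 : ℝ) 1 := by
  rw [← h.sum_mul_app x]
  refine ⟨Finset.sum_nonneg fun y _ => mul_nonneg (ch.nonneg _ _) (ch.app_nonneg _ _), ?_⟩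
  rw [← ch.sum_eq_one x]
  exact Finset.sum_le_sum fun y _ => mul_le_of_le_one_right (ch.nonneg _ _) (ch.app_le_one _ _)

end Symmetry

section Typicality

variable {X : Type u} {Y : Type v} [Fintype Y] {n : ℕ}

/-- The version of `Channel.prob_sum_ge_le` for functions that are not centred. -/
theorem Channel.prob_mean_add_le (ch : Channel X Y) (c : Fin n → X) (g : X → Y → ℝ) (a : ℝ)
    (hg : ∀ x y, |g x y - a| ≤ 1) (hga : ∀ x, ∑ y, ch.W x y * g x y = a) {θ : ℝ}
    (hθ0 : 0 ≤ θ) (hθ1 : θ ≤ 1) :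
    ch.prob c {y | n * (a + θ) ≤ ∑ j, g (c j) (y j)} ≤ Real.exp (-(θ ^ 2 / 4 * n)) := by
  refine le_trans (ch.prob_mono_of_pos c fun y hy _ => ?_)
    (ch.prob_sum_ge_le c (fun j y => g (c j) y - a) (fun j y => hg _ _) (fun j => ?_) hθ0 hθ1)
  · simp only [Set.mem_ofPred_eq, Finset.sum_sub_distrib, Finset.sum_const, Finset.card_univ,
      Fintype.card_fin, nsmul_eq_mul] at hy ⊢
    linarith
  · simp_rw [mul_sub, Finset.sum_sub_distrib, ← Finset.sum_mul, hga, ch.sum_eq_one]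
    ring

variable [Fintype X] [DecidableEq Y]

theorem Channel.IsWeaklySymmetric.prob_sum_app_le {ch : Channel X Y} (h : ch.IsWeaklySymmetric)
    (c : Fin n → X) {θ : ℝ} (hθ0 : 0 ≤ θ) (hθ1 : θ ≤ 1) :
    ch.prob c {y | ∑ j, ch.app (y j) (c j) ≤ n * (ch.kvCapacity - θ)} ≤
      Real.exp (-(θ ^ 2 / 4 * n)) := by
  refine le_trans (ch.prob_mono_of_pos c fun y hy _ => ?_)
    (ch.prob_mean_add_le c (fun x y => -ch.app y x) (-ch.kvCapacity) (fun x y => ?_)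
      (fun x => ?_) hθ0 hθ1)
  · simp only [Set.mem_ofPred_eq, Finset.sum_neg_distrib] at hy ⊢
    linarith
  · obtain ⟨h0, h1⟩ := h.kvCapacity_mem_Icc x
    rw [abs_le]
    constructor <;> linarith [ch.app_nonneg y x, ch.app_le_one y x]
  · simp_rw [mul_neg, Finset.sum_neg_distrib, h.sum_mul_app]

theorem Channel.IsWeaklySymmetric.prob_le_sum_sum_app_sq {ch : Channel X Y}
    (h : ch.IsWeaklySymmetric) (c : Fin n → X) {θ : ℝ} (hθ0 : 0 ≤ θ) (hθ1 : θ ≤ 1) :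
    ch.prob c {y | n * (ch.kvCapacity + θ) ≤ ∑ j, ∑ α, ch.app (y j) α ^ 2} ≤
      Real.exp (-(θ ^ 2 / 4 * n)) := by
  refine ch.prob_mean_add_le c (fun _ y => ∑ α, ch.app y α ^ 2) ch.kvCapacity (fun x y => ?_)
    h.sum_mul_sum_app_sq hθ0 hθ1
  obtain ⟨h0, h1⟩ := h.kvCapacity_mem_Icc x
  rw [abs_le]
  constructor <;> linarith [ch.sum_app_sq_nonneg y, ch.sum_app_sq_le_one y]

end Typicality

end KoetterVardy

/-! ### Interpolation polynomials -/

namespace KoetterVardy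

open Polynomial

section Interpolation

variable {F : Type u} [Field F] {n : ℕ}

/-- The substitution `Q (X, Y) ↦ Q (X + a, Y + b)`. -/
noncomputable def shift (a b : F) : F[X][X] →+* F[X][X] :=
  (compRingHom (X + C (C b))).comp (mapRingHom (compRingHom (X + C a)))

theorem hasZeroOfMultiplicity_iff {Q : F[X][X]} {a b : F} {m : ℕ} :
    HasZeroOfMultiplicity Q a b m ↔ ∀ i j, i + j < m → ((shift a b Q).coeff j).coeff i = 0 :=
  Iff.rfl

theorem shift_C_C (a b c : F) : shift a b (C (C c)) = C (C c) := by
  simp [shift]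

/-- The polynomial `∑ j, p j (X) * Y ^ j`, where `p j` has the coefficients `v j`. -/
noncomputable def ofCoeffs {J : ℕ} {d : Fin J → ℕ} (v : ∀ j, Fin (d j) → F) : F[X][X] :=
  ∑ j : Fin J, monomial (j : ℕ) ((degreeLTEquiv F (d j)).symm (v j) : F[X])

theorem coeff_ofCoeffs {J : ℕ} {d : Fin J → ℕ} (v : ∀ j, Fin (d j) → F) (j : Fin J) :
    (ofCoeffs v).coeff j = ((degreeLTEquiv F (d j)).symm (v j) : F[X]) := by
  simp [ofCoeffs, coeff_monomial, Fin.val_inj]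

theorem coeff_ofCoeffs_of_le {J : ℕ} {d : Fin J → ℕ} (v : ∀ j, Fin (d j) → F) {j : ℕ}
    (hj : J ≤ j) : (ofCoeffs v).coeff j = 0 := by
  rw [ofCoeffs, finsetSum_coeff]
  refine Finset.sum_eq_zero fun i _ => ?_
  rw [coeff_monomial, if_neg]
  have := i.2
  omega

theorem ofCoeffs_add {J : ℕ} {d : Fin J → ℕ} (v v' : ∀ j, Fin (d j) → F) :
    ofCoeffs (v + v') = ofCoeffs v + ofCoeffs v' := by
  simp [ofCoeffs, Finset.sum_add_distrib]

theorem ofCoeffs_smul {J : ℕ} {d : Fin J → ℕ} (c : F) (v : ∀ j, Fin (d j) → F) :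
    ofCoeffs (c • v) = C (C c) * ofCoeffs v := by
  simp [ofCoeffs, Finset.mul_sum, C_mul_monomial, smul_eq_C_mul]

theorem ofCoeffs_ne_zero {J : ℕ} {d : Fin J → ℕ} {v : ∀ j, Fin (d j) → F} (hv : v ≠ 0) :
    ofCoeffs v ≠ 0 := by
  intro h
  refine hv (funext fun j => ?_)
  have h1 := coeff_ofCoeffs v j
  rw [h, coeff_zero] at h1
  have h2 : (degreeLTEquiv F (d j)).symm (v j) = 0 := Subtype.ext h1.symm
  simpa using h2

theorem weightedDegree_ofCoeffs_le {w D J : ℕ} (hJ : ∀ j < J, w * j ≤ D)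
    (v : ∀ j : Fin J, Fin (D + 1 - w * j) → F) : weightedDegree w (ofCoeffs v) ≤ D := by
  refine Finset.sup_le fun j hj => ?_
  rw [mem_support_iff] at hj
  have hjJ : j < J := by
    by_contra h
    exact hj (coeff_ofCoeffs_of_le v (not_lt.mp h))
  have h1 := coeff_ofCoeffs v ⟨j, hjJ⟩
  have h2 := mem_degreeLT.mp ((degreeLTEquiv F (D + 1 - w * j)).symm (v ⟨j, hjJ⟩)).2
  simp only at h1
  rw [← h1, degree_eq_natDegree hj] at h2
  have h3 : ((ofCoeffs v).coeff j).natDegree < D + 1 - w * j := by exact_mod_cast h2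
  have := hJ j hjJ
  omega

/-- There are at least `(D + 1) ^ 2 / (2 * w)` monomials of `(1, w)`-weighted degree at most
`D`. -/
theorem sq_le_card_monomials {w : ℕ} (hw : 0 < w) (D : ℕ) :
    (D + 1) ^ 2 ≤ 2 * w * ∑ j : Fin (D / w + 1), (D + 1 - w * j) := by
  set J := D / w + 1 with hJ
  have h1 : D + 1 ≤ w * J := by
    have := Nat.div_add_mod D w
    have := Nat.mod_lt D hw
    rw [hJ, mul_add]
    omega
  have h2 : w * J ≤ D + w := by
    have := Nat.mul_div_le D w
    rw [hJ, mul_add]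
    omega
  have h3 : ∀ m ≤ J, (2 : ℤ) * ((∑ j ∈ Finset.range m, (D + 1 - w * j) : ℕ) : ℤ) =
      2 * m * (D + 1) - w * m * (m - 1) := by
    intro m
    induction m with
    | zero => simp
    | succ m ih =>
      intro hm
      have h4 : w * m ≤ D + 1 := by
        have := Nat.mul_le_mul_left w hm
        rw [mul_add] at this
        omega
      rw [Finset.sum_range_succ, Nat.cast_add, mul_add, ih (by omega), Nat.cast_sub h4]
      push_cast
      ring
  rw [Fin.sum_univ_eq_sum_range (fun j => D + 1 - w * j) J]
  have h4 := h3 J le_rfl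
  zify at h1 h2 hw ⊢
  have hJ1 : (1 : ℤ) ≤ J := by
    rw [hJ]
    push_cast
    have : (0 : ℤ) ≤ (D : ℤ) / w := by positivity
    linarith
  push_cast at h4
  have h5 : ((w : ℤ) * J - (D + 1)) ^ 2 ≤ (w : ℤ) ^ 2 * J := by
    have : ((w : ℤ) * J - (D + 1)) ^ 2 ≤ (w : ℤ) ^ 2 := by
      apply sq_le_sq'  <;> linarith
    nlinarith [sq_nonneg (w : ℤ)]
  have h6 : (2 * w : ℤ) * ((∑ j ∈ Finset.range J, (D + 1 - w * j) : ℕ) : ℤ) =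
      w * (2 * J * (D + 1) - w * J * (J - 1)) := by
    rw [← h4]
    push_cast
    ring
  push_cast at h6
  rw [h6]
  linarith

/-- A linear system with more coefficients than vanishing conditions has a nontrivial solution. -/
theorem exists_interpolates_of_card_lt [Fintype F] (x : Fin n → F) {w : ℕ} (hw : 0 < w)
    (M : Matrix F (Fin n) ℕ) {D : ℕ}
    (hD : w * ∑ i, ∑ j, M i j * (M i j + 1) < (D + 1) ^ 2) :
    ∃ Q : F[X][X], Q ≠ 0 ∧ Interpolates x M Q ∧ weightedDegree w Q ≤ D := by
  let d : Fin (D / w + 1) → ℕ := fun j => D + 1 - w * j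
  -- the conditions are indexed by a point, a total degree `s` and a degree `a ≤ s` in `X`
  let T : (∀ j, Fin (d j) → F) →ₗ[F]
      ((Σ p : F × Fin n, Σ s : Fin (M p.1 p.2), Fin (s + 1)) → F) :=
    { toFun := fun v p =>
        ((shift (x p.1.2) p.1.1 (ofCoeffs v)).coeff (p.2.1 - p.2.2)).coeff p.2.2
      map_add' := fun v v' => by
        ext p
        simp [ofCoeffs_add]
      map_smul' := fun c v => by
        ext p
        simp [ofCoeffs_smul, shift_C_C] }
  have hcard : 2 * Fintype.card (Σ p : F × Fin n, Σ s : Fin (M p.1 p.2), Fin (s + 1)) =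
      ∑ i, ∑ j, M i j * (M i j + 1) := by
    simp only [Fintype.card_sigma, Fintype.card_fin, Finset.mul_sum]
    rw [Fintype.sum_prod_type]
    refine Finset.sum_congr rfl fun i _ => Finset.sum_congr rfl fun j _ => ?_
    rw [← Finset.mul_sum, Fin.sum_univ_eq_sum_range (fun s => s + 1) (M i j)]
    induction M i j with
    | zero => simp
    | succ m ih =>
      rw [Finset.sum_range_succ, mul_add, ih]
      ring
  have hker : LinearMap.ker T ≠ ⊥ := by
    refine LinearMap.ker_ne_bot_of_finrank_lt ?_
    rw [Module.finrank_fintype_fun_eq_card, Module.finrank_pi_fintype]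
    simp only [Module.finrank_fin_fun]
    have h1 := sq_le_card_monomials hw D
    rw [← hcard] at hD
    have h2 : 2 * w * Fintype.card (Σ p : F × Fin n, Σ s : Fin (M p.1 p.2), Fin (s + 1)) <
        2 * w * ∑ j : Fin (D / w + 1), d j := by
      refine lt_of_lt_of_le ?_ h1
      linarith
    exact lt_of_mul_lt_mul_left h2 (Nat.zero_le _)
  obtain ⟨v, hv, hv0⟩ := (Submodule.ne_bot_iff _).mp hker
  refine ⟨ofCoeffs v, ofCoeffs_ne_zero hv0, ?_, weightedDegree_ofCoeffs_le (fun j hj => ?_) v⟩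
  · intro α j
    rw [hasZeroOfMultiplicity_iff]
    intro a b hab
    have h1 := congr_fun (LinearMap.mem_ker.mp hv)
      ⟨(α, j), ⟨a + b, hab⟩, ⟨a, by simp only; omega⟩⟩
    simpa [T] using h1
  · have h1 : w * j ≤ w * (D / w) := Nat.mul_le_mul_left w (by omega)
    exact h1.trans (Nat.mul_div_le D w)

/-- The weighted degree of an interpolation polynomial is at most the square root of
`2 * (k - 1)` times the cost. -/
theorem IsInterpolationPolynomial.weightedDegree_le [Fintype F] {x : Fin n → F} {k : ℕ}
    (hk : 2 ≤ k) {M : Matrix F (Fin n) ℕ} {Q : F[X][X]}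
    (hQ : IsInterpolationPolynomial x k M Q) :
    weightedDegree (k - 1) Q ≤ Nat.sqrt ((k - 1) * ∑ i, ∑ j, M i j * (M i j + 1)) := by
  obtain ⟨Q', h0, h1, h2⟩ := exists_interpolates_of_card_lt x (w := k - 1) (by omega) M
    (D := Nat.sqrt ((k - 1) * ∑ i, ∑ j, M i j * (M i j + 1))) (Nat.lt_succ_sqrt' _)
  exact (hQ.2.2 Q' h0 h1).trans h2

end Interpolation

/-! ### Factorization -/

section Factorization

variable {F : Type u} [Field F] {n : ℕ}

/-- A zero of multiplicity `m` at a point of the graph of `f` gives a zero of multiplicity `m` of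
`Q (X, f (X))`. -/
theorem HasZeroOfMultiplicity.pow_dvd_eval {Q : F[X][X]} {a b : F} {m : ℕ}
    (h : HasZeroOfMultiplicity Q a b m) {f : F[X]} (hf : f.eval a = b) :
    (X - C a) ^ m ∣ Q.eval f := by
  have h1 : (shift a b Q).eval (f.comp (X + C a) - C b) = (Q.eval f).comp (X + C a) := by
    have h2 : (Q.eval f).comp (X + C a) = compRingHom (X + C a) (Q.eval f) := rfl
    rw [h2, ← eval_map_apply, coe_compRingHom_apply]
    simp [shift, eval_comp]
  have h2 : (X : F[X]) ∣ f.comp (X + C a) - C b := by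
    rw [X_dvd_iff]
    simp [coeff_zero_eq_eval_zero, eval_comp, hf]
  have h3 : (X : F[X]) ^ m ∣ (Q.eval f).comp (X + C a) := by
    rw [← h1, eval_eq_sum_range]
    refine Finset.dvd_sum fun j _ => ?_
    have h4 : (X : F[X]) ^ (m - j) ∣ (shift a b Q).coeff j :=
      X_pow_dvd_iff.mpr fun i hi => h i j (by omega)
    refine (pow_dvd_pow X (show m ≤ m - j + j by omega)).trans ?_
    rw [pow_add]
    exact mul_dvd_mul h4 (pow_dvd_pow_of_dvd h2 j)
  have h4 := map_dvd (compRingHom (X - C a)) h3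
  simpa [comp_assoc] using h4

theorem natDegree_eval_le_weightedDegree {w : ℕ} (Q : F[X][X]) {f : F[X]}
    (hf : f.natDegree ≤ w) : (Q.eval f).natDegree ≤ weightedDegree w Q := by
  rw [eval_eq_sum]
  refine natDegree_sum_le_of_forall_le _ _ fun j hj => ?_
  refine natDegree_mul_le.trans (le_trans ?_
    (Finset.le_sup (f := fun j => (Q.coeff j).natDegree + w * j) hj))
  have h1 : (f ^ j).natDegree ≤ j * f.natDegree := natDegree_pow_le
  have h2 : j * f.natDegree ≤ w * j := by
    rw [mul_comm]
    exact Nat.mul_le_mul_right j hf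
  omega

/-- If the multiplicities along a codeword add up to more than the weighted degree of `Q`, then
the codeword is on the list. -/
theorem mem_factorList_of_weightedDegree_lt {x : Fin n → F} (hx : Function.Injective x) {k : ℕ}
    {M : Matrix F (Fin n) ℕ} {Q : F[X][X]} (hQ : Interpolates x M Q) {c : Fin n → F}
    (hc : c ∈ reedSolomon x k) (h : weightedDegree (k - 1) Q < ∑ j, M (c j) j) :
    c ∈ factorList x k Q := by
  obtain ⟨f, hf, rfl⟩ := hc
  refine ⟨f, hf, ?_, fun j => rfl⟩
  rw [dvd_iff_isRoot, IsRoot.def]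
  by_contra h0
  have hdeg : f.natDegree ≤ k - 1 := by
    rcases eq_or_ne f 0 with rfl | hf0
    · simp
    · have h1 := mem_degreeLT.mp hf
      rw [degree_eq_natDegree hf0] at h1
      have : f.natDegree < k := by exact_mod_cast h1
      omega
  have hdvd : ∏ j, (X - C (x j)) ^ M (f.eval (x j)) j ∣ Q.eval f :=
    Finset.prod_dvd_of_coprime
      (fun i _ j _ hij => (pairwise_coprime_X_sub_C hx hij).pow)
      fun j _ => (hQ _ j).pow_dvd_eval rfl
  have h1 := natDegree_le_of_dvd hdvd h0
  rw [natDegree_prod_of_monic _ _ fun j _ => (monic_X_sub_C (x j)).pow _] at h1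
  simp only [natDegree_pow, natDegree_X_sub_C, mul_one] at h1
  have h2 := natDegree_eval_le_weightedDegree Q hdeg
  have h3 : ∑ j, M (f.eval (x j)) j ≤ weightedDegree (k - 1) Q := h1.trans h2
  exact absurd h (not_lt.mpr h3)

end Factorization

end KoetterVardy

/-! ### The greedy multiplicity assignment -/

namespace KoetterVardy

section Greedy

variable {F : Type u} {n : ℕ} [DecidableEq F]

/-- The invariant of the greedy algorithm: no quotient that was chosen is smaller than one of the
quotients that are still available. -/
theorem IsMultiplicityMatrix.div_le_div {P : Matrix F (Fin n) ℝ} (hP : ∀ i j, 0 ≤ P i j) {s : ℕ}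
    {M : Matrix F (Fin n) ℕ} (h : IsMultiplicityMatrix P s M) {i : F} {j : Fin n}
    (hM : M i j ≠ 0) (i' : F) (j' : Fin n) :
    P i' j' / ((M i' j' : ℝ) + 1) ≤ P i j / (M i j : ℝ) := by
  induction h generalizing i j with
  | zero => simp at hM
  | @step s M i₀ j₀ h hmax ih =>
    have hle : P i' j' / (((M + Matrix.single i₀ j₀ 1 : Matrix F (Fin n) ℕ) i' j' : ℝ) + 1) ≤
        P i' j' / ((M i' j' : ℝ) + 1) := by
      refine div_le_div_of_nonneg_left (hP i' j') (by positivity) ?_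
      simp
    refine hle.trans ?_
    by_cases hij : i₀ = i ∧ j₀ = j
    · obtain ⟨rfl, rfl⟩ := hij
      simpa using hmax i' j'
    · rw [Matrix.add_apply, Matrix.single_apply, if_neg hij, add_zero] at hM ⊢
      exact ih hM

/-- Up to rounding, a multiplicity matrix is a multiple of the reliability matrix. -/
theorem IsMultiplicityMatrix.exists_scale [Fintype F] {P : Matrix F (Fin n) ℝ}
    (hP : ∀ i j, 0 ≤ P i j) {s : ℕ} {M : Matrix F (Fin n) ℕ} (h : IsMultiplicityMatrix P s M)
    {i₀ : F} {j₀ : Fin n} (h0 : 0 < P i₀ j₀) :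
    ∃ lam : ℝ, 0 < lam ∧ ∀ i j, lam * P i j - 1 ≤ M i j ∧ (M i j : ℝ) ≤ lam * P i j := by
  have : Nonempty (F × Fin n) := ⟨(i₀, j₀)⟩
  obtain ⟨p, hp⟩ := Finite.exists_max fun p : F × Fin n => P p.1 p.2 / ((M p.1 p.2 : ℝ) + 1)
  -- the scaling factor is the reciprocal of the largest quotient that is still available
  set μ := P p.1 p.2 / ((M p.1 p.2 : ℝ) + 1) with hμ
  have hμ0 : 0 < μ := lt_of_lt_of_le (by positivity) (hp (i₀, j₀))
  refine ⟨μ⁻¹, by positivity, fun i j => ⟨?_, ?_⟩⟩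
  · have h1 : P i j / ((M i j : ℝ) + 1) ≤ μ := hp (i, j)
    rw [div_le_iff₀ (by positivity)] at h1
    rw [sub_le_iff_le_add, inv_mul_le_iff₀ hμ0]
    exact h1
  · rcases eq_or_ne (M i j) 0 with hM | hM
    · rw [hM, Nat.cast_zero]
      exact mul_nonneg (by positivity) (hP i j)
    · have h1 : μ ≤ P i j / (M i j : ℝ) := h.div_le_div hP hM p.1 p.2
      rw [le_div_iff₀ (by positivity)] at h1
      rw [le_inv_mul_iff₀ hμ0]
      exact h1

end Greedy

end KoetterVardy

/-! ### The list size suffices -/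

namespace KoetterVardy

section ListSize

/-- The list-size bound `L ^ 2 * R* ≤ lam ^ 2 * ν + lam` forces a large scaling factor `lam`. -/
theorem scale_lower_bound {a u s δ lam L η : ℝ} (ha : 0 < a) (hu : 0 < u) (hδ : 0 < δ)
    (hus : 1 ≤ u * s) (has : 2 * η ≤ a * s) (hlam : 0 < lam)
    (hL : 3 * (1 / a ^ 2 + s / (2 * a)) * (1 + δ / 3) / δ ≤ L)
    (hlamL : L ^ 2 * a ^ 2 ≤ lam ^ 2 * u ^ 2 + lam) :
    3 + δ + 3 * η ≤ δ * a * lam * u := by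
  have h1 : 1 / (2 * u) ≤ s / 2 := by
    rw [div_le_div_iff₀ (by positivity) two_pos]
    linarith
  have h2 : L * a ≤ lam * u + s / 2 := by
    have h3 : L * a ≤ lam * u + 1 / (2 * u) := by
      refine le_of_sq_le_sq ?_ (by positivity)
      have h4 : (lam * u + 1 / (2 * u)) ^ 2 = lam ^ 2 * u ^ 2 + lam + (1 / (2 * u)) ^ 2 := by
        field_simp
        ring
      rw [h4, mul_pow]
      linarith [sq_nonneg (1 / (2 * u))]
    linarith
  rw [div_le_iff₀ hδ] at hL
  have h3 : (1 + a * s / 2) * (3 + δ) ≤ L * a * (a * δ) := by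
    have h4 := mul_le_mul_of_nonneg_right hL (sq_nonneg a)
    have h5 : 3 * (1 / a ^ 2 + s / (2 * a)) * (1 + δ / 3) * a ^ 2 =
        (1 + a * s / 2) * (3 + δ) := by
      field_simp
    rw [h5] at h4
    linarith
  have h4 := mul_le_mul_of_nonneg_right h2 (show 0 ≤ a * δ by positivity)
  nlinarith

/-- The numerical heart of the argument, with square roots as variables: `R = r ^ 2`,
`1 + δ = v ^ 2`. -/
theorem rate_gap {R₀ r v θ : ℝ} (hR₀ : 0 < R₀) (hr : R₀ ≤ r ^ 2) (hv : 1 < v)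
    (hrv : r ^ 2 * v ^ 2 ≤ 1) (hθ : θ = (v ^ 2 - 1) * R₀ ^ 3 / 40) :
    r ^ 2 * v + (v ^ 2 - 1) * (r ^ 2 * (v + 1 / 2)) / (v ^ 2 + 2 + 3 * (R₀ / 2)) + 2 * θ <
      r ^ 2 * v ^ 2 - θ := by
  set T := v ^ 2 + 2 + 3 * (R₀ / 2) with hT
  have hT0 : 0 < T := by positivity
  have hδ : 0 < v ^ 2 - 1 := by nlinarith
  have hR1 : R₀ * v ^ 2 ≤ 1 := (mul_le_mul_of_nonneg_right hr (sq_nonneg v)).trans hrv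
  have hR2 : R₀ ≤ 1 := by nlinarith
  have hRT : R₀ * T ≤ 5 := by
    rw [hT]
    nlinarith
  have h1 : 3 * θ * T ≤ 3 / 8 * (v ^ 2 - 1) * R₀ ^ 2 := by
    have h2 := mul_le_mul_of_nonneg_left hRT
      (show 0 ≤ 3 / 40 * (v ^ 2 - 1) * R₀ ^ 2 by positivity)
    rw [hθ]
    linarith
  have h3 : 3 / 4 * (v ^ 2 - 1) * R₀ ≤ (v ^ 2 - v) * T - (v ^ 2 - 1) * (v + 1 / 2) := by
    have h4 : (v ^ 2 - v) * T - (v ^ 2 - 1) * (v + 1 / 2) - 3 / 4 * (v ^ 2 - 1) * R₀ =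
        (v - 1) ^ 2 * (v ^ 2 + 1 / 2 + 3 / 4 * R₀) := by
      rw [hT]
      ring
    have h5 : 0 ≤ (v - 1) ^ 2 * (v ^ 2 + 1 / 2 + 3 / 4 * R₀) := by positivity
    linarith
  have h6 : 3 * θ * T < r ^ 2 * ((v ^ 2 - v) * T - (v ^ 2 - 1) * (v + 1 / 2)) := by
    have h7 : R₀ * (3 / 4 * (v ^ 2 - 1) * R₀) ≤
        r ^ 2 * ((v ^ 2 - v) * T - (v ^ 2 - 1) * (v + 1 / 2)) :=
      mul_le_mul hr h3 (by positivity) (sq_nonneg r)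
    have h8 : 0 < (v ^ 2 - 1) * R₀ ^ 2 := by positivity
    linarith
  have h9 : (v ^ 2 - 1) * (r ^ 2 * (v + 1 / 2)) / T < r ^ 2 * v ^ 2 - r ^ 2 * v - 3 * θ := by
    rw [div_lt_iff₀ hT0]
    linarith
  linarith

/-- For a received word whose normalized score `ρ` and normalized squared norm `ν` are close to
their expectation `R * (1 + δ)`, the chosen list size makes the score of the transmitted word
exceed the bound on the weighted degree. -/
theorem sqrt_lt_score {R₀ R Rs δ ρ ν lam L q : ℝ} (hR₀ : 0 < R₀) (hR : R₀ ≤ R) (hδ : 0 < δ)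
    (hC : R * (1 + δ) ≤ 1) (hRs : R / 2 ≤ Rs) (hRs' : Rs ≤ R) (hq : 2 ≤ q) (hν : 1 ≤ ν * q)
    (hlam : 0 < lam) (hL : 3 * (1 / Rs + √q / (2 * √Rs)) * (1 + δ / 3) / δ ≤ L)
    (hlamL : L ^ 2 * Rs ≤ lam ^ 2 * ν + lam) (hρ : R * (1 + δ) - δ * R₀ ^ 3 / 40 < ρ)
    (hν' : ν < R * (1 + δ) + δ * R₀ ^ 3 / 40) :
    √(Rs * (lam ^ 2 * ν + lam)) < lam * ρ - 1 := by
  have hν0 : 0 < ν := by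
    by_contra h
    nlinarith
  obtain ⟨a, ha0, rfl⟩ : ∃ a, 0 < a ∧ a ^ 2 = Rs :=
    ⟨√Rs, Real.sqrt_pos.mpr (by linarith), Real.sq_sqrt (by linarith)⟩
  obtain ⟨u, hu0, rfl⟩ : ∃ u, 0 < u ∧ u ^ 2 = ν :=
    ⟨√ν, Real.sqrt_pos.mpr hν0, Real.sq_sqrt hν0.le⟩
  obtain ⟨s, hs0, rfl⟩ : ∃ s, 0 < s ∧ s ^ 2 = q :=
    ⟨√q, Real.sqrt_pos.mpr (by linarith), Real.sq_sqrt (by linarith)⟩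
  obtain ⟨r, hr0, rfl⟩ : ∃ r, 0 < r ∧ r ^ 2 = R :=
    ⟨√R, Real.sqrt_pos.mpr (by linarith), Real.sq_sqrt (by linarith)⟩
  obtain ⟨v, hv0, hv⟩ : ∃ v, 0 < v ∧ v ^ 2 = 1 + δ :=
    ⟨√(1 + δ), Real.sqrt_pos.mpr (by linarith), Real.sq_sqrt (by linarith)⟩
  have hv1 : 1 < v := by
    by_contra h
    nlinarith
  obtain rfl : δ = v ^ 2 - 1 := by linarith
  rw [Real.sqrt_sq hs0.le, Real.sqrt_sq ha0.le] at hL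
  rw [← hv] at hC hρ hν'
  set θ := (v ^ 2 - 1) * R₀ ^ 3 / 40 with hθ
  have hθ0 : 0 < θ := by positivity
  have har : a ≤ r := le_of_sq_le_sq hRs' hr0.le
  have hR1 : R₀ ≤ 1 := by nlinarith
  have hus : 1 ≤ u * s := by
    refine le_of_sq_le_sq ?_ (by positivity)
    rw [mul_pow]
    linarith
  have has : 2 * (R₀ / 2) ≤ a * s := by
    refine le_of_sq_le_sq ?_ (by positivity)
    rw [mul_pow]
    nlinarith
  have hT := scale_lower_bound ha0 hu0 hδ hus has hlam hL hlamL
  have hgap := rate_gap hR₀ hR hv1 hC hθ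
  rw [show 3 + (v ^ 2 - 1) + 3 * (R₀ / 2) = v ^ 2 + 2 + 3 * (R₀ / 2) by ring] at hT
  set T := v ^ 2 + 2 + 3 * (R₀ / 2) with hTdef
  have hT0 : 0 < T := by positivity
  have hu : u ≤ r * v + θ / r := by
    refine le_of_sq_le_sq ?_ (by positivity)
    have h1 : (r * v + θ / r) ^ 2 = r ^ 2 * v ^ 2 + 2 * v * θ + (θ / r) ^ 2 := by
      field_simp
      ring
    rw [h1]
    nlinarith [sq_nonneg (θ / r)]
  have hru : r * u ≤ r ^ 2 * v + θ := by
    have h1 := mul_le_mul_of_nonneg_left hu hr0.le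
    have h2 : r * (r * v + θ / r) = r ^ 2 * v + θ := by
      field_simp
    linarith
  have hau : a * u ≤ r ^ 2 * v + θ := (mul_le_mul_of_nonneg_right har hu0.le).trans hru
  have hkey : a * u + (v ^ 2 - 1) * (a * u + a ^ 2 / 2) / T < ρ := by
    have h1 : (v ^ 2 - 1) * (a * u + a ^ 2 / 2) / T ≤
        (v ^ 2 - 1) * (r ^ 2 * (v + 1 / 2)) / T + θ := by
      rw [div_add' _ _ _ hT0.ne', div_le_div_iff_of_pos_right hT0]
      have h2 : (v ^ 2 - 1) * (a * u + a ^ 2 / 2) ≤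
          (v ^ 2 - 1) * (r ^ 2 * v + θ + r ^ 2 / 2) :=
        mul_le_mul_of_nonneg_left (by linarith) hδ.le
      have h3 : (v ^ 2 - 1) * θ ≤ θ * T := by
        rw [mul_comm]
        exact mul_le_mul_of_nonneg_left (by linarith) hθ0.le
      linarith
    linarith
  -- `√(x ^ 2 + lam)` is at most its tangent at `x = lam * u`
  have hsqrt : √(a ^ 2 * (lam ^ 2 * u ^ 2 + lam)) ≤ a * (lam * u + 1 / (2 * u)) := by
    refine Real.sqrt_le_iff.mpr ⟨by positivity, ?_⟩
    have h1 : (a * (lam * u + 1 / (2 * u))) ^ 2 =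
        a ^ 2 * (lam ^ 2 * u ^ 2 + lam) + (a * (1 / (2 * u))) ^ 2 := by
      field_simp
      ring
    rw [h1]
    linarith [sq_nonneg (a * (1 / (2 * u)))]
  have hround : 1 + a / (2 * u) ≤ lam * ((v ^ 2 - 1) * (a * u + a ^ 2 / 2) / T) := by
    rw [mul_div_assoc', le_div_iff₀ hT0]
    calc (1 + a / (2 * u)) * T ≤ (1 + a / (2 * u)) * ((v ^ 2 - 1) * a * lam * u) :=
          mul_le_mul_of_nonneg_left hT (by positivity)
      _ = lam * ((v ^ 2 - 1) * (a * u + a ^ 2 / 2)) := by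
          field_simp
  have h1 := mul_lt_mul_of_pos_left hkey hlam
  have h2 : a * (lam * u + 1 / (2 * u)) = lam * (a * u) + a / (2 * u) := by
    field_simp
  linarith

end ListSize

end KoetterVardy

/-! ### Decoding of typical received words -/

namespace KoetterVardy

section Decoding

variable {F : Type u} [Field F] [Fintype F] [DecidableEq F] {n : ℕ}

/-- Sufficient condition for the sent codeword to be on the list, in terms of the normalized
score `ρ` of the codeword and the normalized squared norm `ν` of the reliability matrix. -/
theorem mem_of_isDecoderOutput {x : Fin n → F} (hx : Function.Injective x) {k L : ℕ}
    (hk : 2 ≤ k) (hn : 0 < n) {P : Matrix F (Fin n) ℝ} (hP : ∀ α j, 0 ≤ P α j)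
    (hsum : ∀ j, ∑ α, P α j = 1) {c : Fin n → F} (hc : c ∈ reedSolomon x k)
    {l : Set (Fin n → F)} (hl : IsDecoderOutput x k L P l) {ρ ν : ℝ}
    (hρ : ∑ j, P (c j) j = n * ρ) (hν : ∑ j, ∑ α, P α j ^ 2 = n * ν)
    (h : ∀ lam : ℝ, 0 < lam → (L : ℝ) ^ 2 * (((k : ℝ) - 1) / n) ≤ lam ^ 2 * ν + lam →
      √(((k : ℝ) - 1) / n * (lam ^ 2 * ν + lam)) < lam * ρ - 1) : c ∈ l := by
  obtain ⟨s, M, Q, hM, hL, -, hQ, rfl⟩ := hl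
  have hn0 : (0 : ℝ) < n := by exact_mod_cast hn
  have hw : ((k - 1 : ℕ) : ℝ) = (k : ℝ) - 1 := by
    rw [Nat.cast_sub (by omega), Nat.cast_one]
  have hw0 : (0 : ℝ) < (k : ℝ) - 1 := by
    rw [← hw]
    exact_mod_cast (by omega : 0 < k - 1)
  obtain ⟨α₀, -, h0⟩ : ∃ α ∈ Finset.univ, 0 < P α ⟨0, hn⟩ := by
    refine Finset.exists_lt_of_sum_lt ?_
    rw [hsum, Finset.sum_const_zero]
    exact one_pos
  obtain ⟨lam, hlam, hMP⟩ := hM.exists_scale hP h0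
  have hscore : n * (lam * ρ - 1) ≤ ∑ j, (M (c j) j : ℝ) := by
    calc n * (lam * ρ - 1) = ∑ j, (lam * P (c j) j - 1) := by
          rw [Finset.sum_sub_distrib, ← Finset.mul_sum, hρ]
          simp
          ring
      _ ≤ ∑ j, (M (c j) j : ℝ) := Finset.sum_le_sum fun j _ => (hMP _ _).1
  set D : ℕ := ∑ i, ∑ j, M i j * (M i j + 1) with hD
  have hcost : (D : ℝ) ≤ n * (lam ^ 2 * ν + lam) := by
    calc (D : ℝ) = ∑ i, ∑ j, (M i j : ℝ) * (M i j + 1) := by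
          rw [hD]
          push_cast
          rfl
      _ ≤ ∑ i, ∑ j, (lam ^ 2 * P i j ^ 2 + lam * P i j) := by
          refine Finset.sum_le_sum fun i _ => Finset.sum_le_sum fun j _ => ?_
          have h1 := (hMP i j).2
          have h2 := mul_le_mul h1 h1 (Nat.cast_nonneg _) (mul_nonneg hlam.le (hP i j))
          linarith
      _ = lam ^ 2 * ∑ j, ∑ i, P i j ^ 2 + lam * ∑ j, ∑ i, P i j := by
          rw [Finset.sum_comm]
          simp_rw [Finset.sum_add_distrib, Finset.mul_sum]
      _ = n * (lam ^ 2 * ν + lam) := by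
          rw [hν]
          simp only [hsum, Finset.sum_const, Finset.card_univ, Fintype.card_fin, nsmul_eq_mul]
          ring
  have hLD : (L : ℝ) ^ 2 * ((k : ℝ) - 1) ≤ D := by
    have h1 : listBound k M = √((D : ℝ) / ((k : ℝ) - 1)) := by
      unfold listBound cost
      rw [hD]
      push_cast
      congr 2
      ring
    rw [h1, Real.le_sqrt (Nat.cast_nonneg _) (by positivity), le_div_iff₀ hw0] at hL
    exact hL
  have hgap := h lam hlam (by
    rw [mul_div_assoc', div_le_iff₀ hn0]
    linarith)
  refine mem_factorList_of_weightedDegree_lt hx hQ.2.1 hc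
    ((hQ.weightedDegree_le hk).trans_lt ?_)
  have h1 : ((Nat.sqrt ((k - 1) * D) : ℕ) : ℝ) < ((∑ j, M (c j) j : ℕ) : ℝ) := by
    calc ((Nat.sqrt ((k - 1) * D) : ℕ) : ℝ) ≤ √(((k - 1) * D : ℕ) : ℝ) :=
          Real.nat_sqrt_le_real_sqrt
      _ ≤ √((n : ℝ) ^ 2 * (((k : ℝ) - 1) / n * (lam ^ 2 * ν + lam))) := by
          refine Real.sqrt_le_sqrt ?_
          rw [Nat.cast_mul, hw]
          calc ((k : ℝ) - 1) * D ≤ ((k : ℝ) - 1) * (n * (lam ^ 2 * ν + lam)) :=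
                mul_le_mul_of_nonneg_left hcost hw0.le
            _ = _ := by field_simp
      _ = n * √(((k : ℝ) - 1) / n * (lam ^ 2 * ν + lam)) := by
          rw [Real.sqrt_mul (by positivity), Real.sqrt_sq hn0.le]
      _ < n * (lam * ρ - 1) := mul_lt_mul_of_pos_left hgap hn0
      _ ≤ ∑ j, (M (c j) j : ℝ) := hscore
      _ = _ := by push_cast; rfl
  exact_mod_cast h1

end Decoding

end KoetterVardy

theorem mainTheorem3 (R₀ : ℝ) (hR₀ : 0 < R₀) :
    ∃ K A : ℝ, 0 < K ∧ 0 < A ∧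
      ∀ (F : Type u) [Field F] [Fintype F] [DecidableEq F]
        (Y : Type v) [Fintype Y] [DecidableEq Y]
        (ch : KoetterVardy.Channel F Y), ch.IsWeaklySymmetric →
      ∀ (n k : ℕ) (x : Fin n → F), Function.Injective x → 2 ≤ k → k ≤ n →
      ∀ (R δ Rstar : ℝ) (L : ℕ),
        R = (k : ℝ) / (n : ℝ) →
        R₀ ≤ R → R < ch.kvCapacity →
        δ = (ch.kvCapacity - R) / R →
        Rstar = ((k : ℝ) - 1) / (n : ℝ) →
        L = ⌈3 * (1 / Rstar + √(Fintype.card F : ℝ) / (2 * √Rstar)) * (1 + δ / 3) / δ⌉₊ →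
      ∀ dec : (Fin n → Y) → Set (Fin n → F),
        KoetterVardy.IsKoetterVardyDecoder ch x k L dec →
      ∀ c ∈ KoetterVardy.reedSolomon x k,
        ch.prob c {y | c ∉ dec y} ≤ A * Real.exp (-(K * δ ^ 2 * (n : ℝ))) := by
  refine ⟨R₀ ^ 6 / 6400, 2, by positivity, two_pos, ?_⟩
  intro F _ _ _ Y _ _ ch hch n k x hx hk hkn R δ Rstar L hR hR₀R hRC hδ hRstar hL dec hdec c hc
  have hn : 0 < n := by omega
  have hn0 : (0 : ℝ) < n := by exact_mod_cast hn
  have hk2 : (2 : ℝ) ≤ k := by exact_mod_cast hk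
  have hR0 : 0 < R := hR₀.trans_le hR₀R
  have hC : ch.kvCapacity = R * (1 + δ) := by
    rw [hδ]
    field_simp
    ring
  have hC1 : R * (1 + δ) ≤ 1 := hC ▸ (hch.kvCapacity_mem_Icc 0).2
  have hδ0 : 0 < δ := hδ ▸ div_pos (by linarith) hR0
  have hq : (2 : ℝ) ≤ Fintype.card F := by exact_mod_cast Fintype.one_lt_card (α := F)
  -- the admissible deviation of the normalized score and squared norm from their expectation
  set θ := δ * R₀ ^ 3 / 40 with hθ
  have hθ0 : 0 ≤ θ := by positivity
  have hθ1 : θ ≤ 1 := by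
    have h1 : R₀ * (1 + δ) ≤ 1 :=
      (mul_le_mul_of_nonneg_right hR₀R (by positivity)).trans hC1
    have h2 : R₀ ^ 2 ≤ 1 := pow_le_one₀ hR₀.le (by nlinarith)
    have h3 : R₀ * δ * R₀ ^ 2 ≤ 1 := mul_le_one₀ (by linarith) (sq_nonneg _) h2
    linarith
  have hsub : ch.prob c {y | c ∉ dec y} ≤ ch.prob c
      ({y | ∑ j, ch.app (y j) (c j) ≤ n * (ch.kvCapacity - θ)} ∪
        {y | n * (ch.kvCapacity + θ) ≤ ∑ j, ∑ α, ch.app (y j) α ^ 2}) := by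
    refine ch.prob_mono_of_pos c fun y hy hpos => ?_
    by_contra hcon
    simp only [Set.mem_union, Set.mem_ofPred_eq, not_or, not_le] at hcon
    have hW : ∀ j, 0 < ch.W (c j) (y j) := fun j =>
      (ch.nonneg _ _).lt_of_ne' fun h0 => hpos.ne' (Finset.prod_eq_zero (Finset.mem_univ j) h0)
    refine hy (KoetterVardy.mem_of_isDecoderOutput hx hk hn (P := ch.reliability y)
      (fun α j => ch.app_nonneg _ _) (fun j => ch.sum_app (hW j)) hc (hdec y)
      (ρ := (∑ j, ch.app (y j) (c j)) / n) (ν := (∑ j, ∑ α, ch.app (y j) α ^ 2) / n)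
      ?_ ?_ fun lam hlam hlamL => ?_)
    · rw [mul_div_cancel₀ _ hn0.ne']
      rfl
    · rw [mul_div_cancel₀ _ hn0.ne']
      rfl
    refine KoetterVardy.sqrt_lt_score hR₀ hR₀R hδ0 hC1 ?_ ?_ hq ?_ hlam ?_ hlamL ?_ ?_
    · rw [hR, div_div, mul_comm, ← div_div]
      gcongr
      linarith
    · rw [hR]
      gcongr
      linarith
    · -- the Cauchy-Schwarz inequality in each column of the reliability matrix
      rw [div_mul_eq_mul_div, le_div_iff₀ hn0, one_mul, Finset.sum_mul]
      calc (n : ℝ) = ∑ _j : Fin n, (1 : ℝ) := by simp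
        _ ≤ _ := Finset.sum_le_sum fun j _ => by
          have h1 := sq_sum_le_card_mul_sum_sq (s := Finset.univ) (f := fun α => ch.app (y j) α)
          rw [ch.sum_app (hW j), one_pow, Finset.card_univ] at h1
          linarith
    · rw [← hRstar, hL]
      exact Nat.le_ceil _
    · rw [← hC, lt_div_iff₀ hn0, mul_comm]
      exact hcon.1
    · rw [← hC, div_lt_iff₀ hn0, mul_comm]
      exact hcon.2
  refine hsub.trans ((ch.prob_union_le c _ _).trans ((add_le_add
    (hch.prob_sum_app_le c hθ0 hθ1) (hch.prob_le_sum_sum_app_sq c hθ0 hθ1)).trans_eq ?_))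
  rw [← two_mul, hθ]
  congr 3
  ring
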